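/- Let $\mathsf{AP}$ be a finite set of atomic propositions, let $\phi$ be an EMITL formula over $\mathsf{AP}$ in negative normal form (built from $\top,\bot,p,\neg p,\wedge,\vee$ and automata modalities $\mathcal A_I$, $\tilde{\mathcal A}_I$, where $\mathcal A$ is an NFA over $\{1,\dots,n\}$ with one initial location and $I$ is an interval with endpoints in $\mathbb N\cup\{\infty\}$; in particular $\phi$ may be any $\mathrm{EMITL}_{0,\infty}$ formula), and let $\Phi$ be its set of temporal subformulae. Let $\mathsf{AP}_\Phi=\{p_\chi\mid\chi\in\Phi\}$ be fresh propositions and, for a subformula $\chi$ of $\phi$, let $\overline\chi$ be obtained from $\chi$ by replacing each top-level temporal subformula $\chi'$ by $p_{\chi'}$. Formulae over $\mathsf{AP}\cup\mathsf{AP}_\Phi$ are interpreted in the pointwise semantics over infinite non-Zeno timed words over $\Sigma=2^{\mathsf{AP}\cup\mathsf{AP}_\Phi}$: $(\rho,i)\models\mathcal A_I(\phi_1,\dots,\phi_n)$ iff for some $j\ge i$ with $\tau_j-\tau_i\in I$, $\mathcal A$ accepts some word $a_i\dots a_j$ with $(\rho,\ell)\models\phi_{a_\ell}$ for all $i\le\ell\le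 j$; $\tilde{\mathcal A}_I(\phi_1,\dots,\phi_n)$ means $\neg\mathcal A_I(\neg\phi_1,\dots,\neg\phi_n)$; $\mathbf G$ refers to all positions from the current one on. Let $\psi=\tilde{\mathcal A}_{\le c}(\phi_1,\dots,\phi_n)\in\Phi$ with $c\in\mathbb N$, and let $\mathcal A$ have locations $S^{\mathcal A}$, $|S^{\mathcal A}|=m$, initial location $s_0^{\mathcal A}$ and final locations $F^{\mathcal A}$. For $S,S'\subseteq S^{\mathcal A}$ and $\sigma\in\Sigma$ write $S\xrightarrow[\wedge]{\sigma}S'$ iff $S'$ is a minimal set such that for each $s\in S$ and each transition $(s,a,s')$ of $\mathcal A$, $s'\in S'$ or $\sigma\models\overline{\phi_a}$. Let $\mathcal C^\psi$ be the timed automaton over $\Sigma$ with locations $\langle S_1,\dots,S_{m+1}\rangle$, $S_j\subseteq S^{\mathcal A}$, initial location $\langle\emptyset,\dots,\emptyset\rangle$, clocks $x_1,\dots,x_{m+1}$, every run accepting, whose transitions are obtained by synchronising transitions of the $m+1$ sub-components (with conjunction of guards and union of resets). A sub-component with set $S$ and clock $x$ can go to $S'$ as follows. If $p_\psi\notin\sigma$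 (never resetting $x$): (1) $S=S'=\emptyset$, guard $\top$; (2) $S\xrightarrow[\wedge]{\sigma}S'$, $S'\cap F^{\mathcal A}=\emptyset$, guard $x\le c$; (3) $S'=\emptyset$, guard $x>c$. If $p_\psi\in\sigma$ (always resetting $x$, and always with $S'\cap F^{\mathcal A}=\emptyset$): (4) $S=\emptyset$, $\{s_0^{\mathcal A}\}\xrightarrow[\wedge]{\sigma}S'$, guard $\top$; (5) $S'=S''\cup S'''$ with $S\xrightarrow[\wedge]{\sigma}S''$ and $\{s_0^{\mathcal A}\}\xrightarrow[\wedge]{\sigma}S'''$, guard $x\le c$; (6) $\{s_0^{\mathcal A}\}\xrightarrow[\wedge]{\sigma}S'$, guard $x>c$. If $p_\psi\notin\sigma$, all sub-components take transitions (1)–(3); if $p_\psi\in\sigma$, exactly one takes a transition (4)–(6) and the others take transitions (1)–(3). Then the timed language accepted by $\mathcal C^\psi$ is exactly the set of timed words satisfying $\mathbf G\big(p_\psi\Rightarrow\tilde{\mathcal A}_{\le c}(\overline{\phi_1},\dots,\overline{\phi_n})\big)$ at their first position. -/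

import Mathlib

open Set Filter

universe u

namespace EMITLTA

/-! ## Timed words -/

/-- An infinite non-Zeno timed word over the alphabet `L`. Position `i + 1` of the word (positions
start from one in the usual notation) is the index `i : ℕ` here. -/
structure TimedWord (L : Type u) where
  letter : ℕ → L
  time : ℕ → ℝ
  time_nonneg : ∀ i, 0 ≤ time i
  time_mono : Monotone time
  time_unbounded : ∀ r : ℝ, 0 ≤ r → ∃ j, r ≤ time j

/-- The time elapsed between the previous event (or the origin of time, for the first event) and
the event of index `i`. -/
def TimedWord.delay {L : Type u} (ρ : TimedWord L) : ℕ → ℝ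
  | 0 => ρ.time 0
  | i + 1 => ρ.time (i + 1) - ρ.time i

/-! ## Nondeterministic finite automata -/

/-- Nondeterministic finite automata with a single initial location. -/
structure FinAut (α : Type) : Type 1 where
  Loc : Type
  finite_loc : Finite Loc
  init : Loc
  trans : Set (Loc × α × Loc)
  final : Set Loc

/-- `r 0, r 1, …, r w.length` is an accepting run of `A` on `w`; the values of `r` beyond
`w.length` are irrelevant. -/
def FinAut.IsAcceptingRun {α : Type} (A : FinAut α) (w : List α) (r : ℕ → A.Loc) : Prop :=
  r 0 = A.init ∧ (∀ (k : ℕ) (hk : k < w.length), (r k, w[k], r (k + 1)) ∈ A.trans) ∧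
    r w.length ∈ A.final

/-- Acceptance of a nonempty finite word. -/
def FinAut.Accepts {α : Type} (A : FinAut α) (w : List α) : Prop :=
  w ≠ [] ∧ ∃ r : ℕ → A.Loc, A.IsAcceptingRun w r

/-! ## EMITL -/

/-- Intervals of nonnegative reals with endpoints in `ℕ ∪ {∞}`. Singular intervals are not
excluded, so that `[0, c]` is available for every `c : ℕ`. -/
inductive TimeInterval : Type
  | icc (a b : ℕ)
  | ico (a b : ℕ)
  | ioc (a b : ℕ)
  | ioo (a b : ℕ)
  | ici (a : ℕ)
  | ioi (a : ℕ)

def TimeInterval.toSet : TimeInterval → Set ℝ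
  | icc a b => Set.Icc (a : ℝ) b
  | ico a b => Set.Ico (a : ℝ) b
  | ioc a b => Set.Ioc (a : ℝ) b
  | ioo a b => Set.Ioo (a : ℝ) b
  | ici a => Set.Ici (a : ℝ)
  | ioi a => Set.Ioi (a : ℝ)

/-- Formulae of EMITL over the atomic propositions `P`; `aut A I φ` is `A_I(φ₁, …, φₙ)`. -/
inductive EMITL (P : Type u) : Type (max u 1)
  | top : EMITL P
  | atom (p : P) : EMITL P
  | and (φ₁ φ₂ : EMITL P) : EMITL P
  | neg (φ : EMITL P) : EMITL P
  | aut {n : ℕ} (A : FinAut (Fin n)) (I : TimeInterval) (φ : Fin n → EMITL P) : EMITL P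

namespace EMITL

variable {P : Type u}

/-- Pointwise semantics: `φ.Sat ρ i` is `(ρ, i) ⊨ φ`. The word `a_i … a_j` is the list `w`. -/
def Sat : EMITL P → TimedWord (Set P) → ℕ → Prop
  | top, _, _ => True
  | atom p, ρ, i => p ∈ ρ.letter i
  | and φ₁ φ₂, ρ, i => φ₁.Sat ρ i ∧ φ₂.Sat ρ i
  | neg φ, ρ, i => ¬ φ.Sat ρ i
  | aut (n := n) A I φ, ρ, i =>
      ∃ j, i ≤ j ∧ ρ.time j - ρ.time i ∈ I.toSet ∧
        ∃ w : List (Fin n), i + w.length = j + 1 ∧ A.Accepts w ∧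
          ∀ (k : ℕ) (hk : k < w.length), (φ w[k]).Sat ρ (i + k)

/-- The timed language of a formula. -/
def language (φ : EMITL P) : Set (TimedWord (Set P)) := {ρ | φ.Sat ρ 0}

def bot : EMITL P := neg top

def or (φ₁ φ₂ : EMITL P) : EMITL P := neg (and (neg φ₁) (neg φ₂))

def imp (φ₁ φ₂ : EMITL P) : EMITL P := or (neg φ₁) φ₂

/-- The dual automata modality `Ã_I(φ₁, …, φₙ) ≡ ¬ A_I(¬φ₁, …, ¬φₙ)`. -/
def dualAut {n : ℕ} (A : FinAut (Fin n)) (I : TimeInterval) (φ : Fin n → EMITL P) : EMITL P :=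
  neg (aut A I fun a => neg (φ a))

/-- The automaton of the `until` modality: it accepts the words `1 … 1 2`, i.e. the words over
`Fin 2` that consist of letters `0` followed by one letter `1`. The location `false` is initial
and `true` is final. -/
def untilAut : FinAut (Fin 2) where
  Loc := Bool
  finite_loc := inferInstance
  init := false
  trans := {(false, 0, false), (false, 1, true)}
  final := {true}

/-- The (non-strict) `until`. -/
def until_ (I : TimeInterval) (φ₁ φ₂ : EMITL P) : EMITL P := aut untilAut I ![φ₁, φ₂]

/-- `◇ φ`, with the trivial constraint `[0, ∞)`. -/
def eventually (φ : EMITL P) : EMITL P := until_ (.ici 0) top φ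

/-- `□ φ`, with the trivial constraint `[0, ∞)`. -/
def globally (φ : EMITL P) : EMITL P := neg (eventually (neg φ))

end EMITL

/-! ## Negative normal form, triggers, and the formulae `φ̄` -/

/-- EMITL formulae in negative normal form. -/
inductive NNF (P : Type u) : Type (max u 1)
  | top : NNF P
  | bot : NNF P
  | atom (p : P) : NNF P
  | natom (p : P) : NNF P
  | and (φ₁ φ₂ : NNF P) : NNF P
  | or (φ₁ φ₂ : NNF P) : NNF P
  | aut {n : ℕ} (A : FinAut (Fin n)) (I : TimeInterval) (φ : Fin n → NNF P) : NNF P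
  | dualAut {n : ℕ} (A : FinAut (Fin n)) (I : TimeInterval) (φ : Fin n → NNF P) : NNF P

namespace NNF

variable {P : Type u}

/-- The EMITL formula written by an expression in negative normal form. -/
def toEMITL : NNF P → EMITL P
  | top => .top
  | bot => .bot
  | atom p => .atom p
  | natom p => .neg (.atom p)
  | and φ₁ φ₂ => .and φ₁.toEMITL φ₂.toEMITL
  | or φ₁ φ₂ => .or φ₁.toEMITL φ₂.toEMITL
  | aut A I φ => .aut A I fun a => (φ a).toEMITL
  | dualAut A I φ => .dualAut A I fun a => (φ a).toEMITL

/-- The set of temporal subformulae: those whose outermost operator is `A_I` or `Ã_I`. -/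
def temporal : NNF P → Set (NNF P)
  | top => ∅
  | bot => ∅
  | atom _ => ∅
  | natom _ => ∅
  | and φ₁ φ₂ => φ₁.temporal ∪ φ₂.temporal
  | or φ₁ φ₂ => φ₁.temporal ∪ φ₂.temporal
  | aut A I φ => insert (aut A I φ) (⋃ a, (φ a).temporal)
  | dualAut A I φ => insert (dualAut A I φ) (⋃ a, (φ a).temporal)

/-- The atomic propositions `AP ∪ AP_Φ`, where `Φ` is the set of temporal subformulae of `φ`:
the trigger `p_ψ` of `ψ ∈ Φ` is `Sum.inr ψ`. -/
abbrev ExtAtom (φ : NNF P) : Type (max u 1) := P ⊕ {ψ : NNF P // ψ ∈ φ.temporal}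

theorem temporal_arg_subset_of_dualAut_mem {φ : NNF P} {n : ℕ} {A : FinAut (Fin n)}
    {I : TimeInterval} {args : Fin n → NNF P} (h : dualAut A I args ∈ φ.temporal) (a : Fin n) :
    (args a).temporal ⊆ φ.temporal := by
  induction φ with
  | top => simp [temporal] at h
  | bot => simp [temporal] at h
  | atom p => simp [temporal] at h
  | natom p => simp [temporal] at h
  | and φ₁ φ₂ ih₁ ih₂ =>
    simp only [temporal, mem_union] at h ⊢
    rcases h with h | h
    · exact (ih₁ h).trans subset_union_left
    · exact (ih₂ h).trans subset_union_right
  | or φ₁ φ₂ ih₁ ih₂ =>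
    simp only [temporal, mem_union] at h ⊢
    rcases h with h | h
    · exact (ih₁ h).trans subset_union_left
    · exact (ih₂ h).trans subset_union_right
  | aut B J ψ ih =>
    simp only [temporal, mem_insert_iff, mem_iUnion, reduceCtorEq, false_or] at h ⊢
    obtain ⟨b, hb⟩ := h
    exact ((ih b hb).trans (subset_iUnion (fun a => (ψ a).temporal) b)).trans (subset_insert _ _)
  | dualAut B J ψ ih =>
    rcases mem_insert_iff.1 h with h | h
    · cases h
      exact (subset_iUnion (fun a => (args a).temporal) a).trans (subset_insert _ _)
    · obtain ⟨b, hb⟩ := mem_iUnion.1 h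
      exact ((ih b hb).trans (subset_iUnion (fun a => (ψ a).temporal) b)).trans
        (subset_insert _ _)

end NNF

/-- Positive Boolean combinations of atomic propositions and their negations. -/
inductive BoolForm (P : Type u) : Type u
  | top : BoolForm P
  | bot : BoolForm P
  | atom (p : P) : BoolForm P
  | natom (p : P) : BoolForm P
  | and (β₁ β₂ : BoolForm P) : BoolForm P
  | or (β₁ β₂ : BoolForm P) : BoolForm P

namespace BoolForm

variable {P : Type u}

/-- Satisfaction `σ ⊨ β` by a single letter. -/
def Holds : BoolForm P → Set P → Prop
  | top, _ => True
  | bot, _ => False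
  | atom p, σ => p ∈ σ
  | natom p, σ => p ∉ σ
  | and β₁ β₂, σ => β₁.Holds σ ∧ β₂.Holds σ
  | or β₁ β₂, σ => β₁.Holds σ ∨ β₂.Holds σ

def toEMITL : BoolForm P → EMITL P
  | top => .top
  | bot => .bot
  | atom p => .atom p
  | natom p => .neg (.atom p)
  | and β₁ β₂ => .and β₁.toEMITL β₂.toEMITL
  | or β₁ β₂ => .or β₁.toEMITL β₂.toEMITL

end BoolForm

/-- The formula `χ̄`, obtained from `χ` by replacing its top-level temporal subformulae by their
triggers; `χ` has to be such that all of its temporal subformulae occur in `φ`. -/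
def NNF.bar {P : Type u} (φ : NNF P) :
    (χ : NNF P) → χ.temporal ⊆ φ.temporal → BoolForm φ.ExtAtom
  | .top, _ => .top
  | .bot, _ => .bot
  | .atom p, _ => .atom (Sum.inl p)
  | .natom p, _ => .natom (Sum.inl p)
  | .and χ₁ χ₂, h =>
      .and (φ.bar χ₁ (subset_union_left.trans h)) (φ.bar χ₂ (subset_union_right.trans h))
  | .or χ₁ χ₂, h =>
      .or (φ.bar χ₁ (subset_union_left.trans h)) (φ.bar χ₂ (subset_union_right.trans h))
  | .aut A I χ, h => .atom (Sum.inr ⟨.aut A I χ, h (mem_insert _ _)⟩)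
  | .dualAut A I χ, h => .atom (Sum.inr ⟨.dualAut A I χ, h (mem_insert _ _)⟩)

/-! ## Timed automata -/

/-- The comparisons allowed in clock constraints. -/
inductive Cmp : Type
  | le
  | lt
  | ge
  | gt

def Cmp.Holds : Cmp → ℝ → ℝ → Prop
  | le, a, b => a ≤ b
  | lt, a, b => a < b
  | ge, a, b => a ≥ b
  | gt, a, b => a > b

/-- Clock constraints over the clocks `X`. -/
inductive Guard (X : Type) : Type
  | top : Guard X
  | and (g₁ g₂ : Guard X) : Guard X
  | cmp (x : X) (r : Cmp) (c : ℕ) : Guard X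

/-- Satisfaction of a clock constraint by a valuation. -/
def Guard.Sat {X : Type} : Guard X → (X → ℝ) → Prop
  | top, _ => True
  | and g₁ g₂, v => g₁.Sat v ∧ g₂.Sat v
  | cmp x r c, v => r.Holds (v x) c

/-- The conjunction of a finite list of clock constraints. -/
def Guard.conj {X : Type} (gs : List (Guard X)) : Guard X := gs.foldr Guard.and Guard.top

/-- Timed automata with a generalised Büchi acceptance condition: `final` is the set of the sets
of final locations. -/
structure TimedAut (L : Type u) : Type (max u 1) where
  Loc : Type
  finite_loc : Finite Loc
  init : Loc
  Clock : Type
  finite_clock : Finite Clock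
  trans : Set (Loc × L × Guard Clock × Set Clock × Loc)
  final : Set (Set Loc)

namespace TimedAut

variable {L : Type u}

open Classical in
/-- The valuation `v[r ← 0]`. -/
noncomputable def reset {X : Type} (v : X → ℝ) (r : Set X) : X → ℝ :=
  fun x => if x ∈ r then 0 else v x

/-- The sequence of states `(s i, v i)` is a run of `C` on `ρ`. The clock values along a run are
automatically nonnegative. -/
def IsRun (C : TimedAut L) (ρ : TimedWord L) (s : ℕ → C.Loc) (v : ℕ → C.Clock → ℝ) : Prop :=
  s 0 = C.init ∧ (∀ x, v 0 x = 0) ∧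
    ∀ i, ∃ (g : Guard C.Clock) (r : Set C.Clock),
      (s i, ρ.letter i, g, r, s (i + 1)) ∈ C.trans ∧
      g.Sat (fun x => v i x + ρ.delay i) ∧
      v (i + 1) = reset (fun x => v i x + ρ.delay i) r

/-- Generalised Büchi acceptance. -/
def IsAccepting (C : TimedAut L) (s : ℕ → C.Loc) : Prop :=
  ∀ F ∈ C.final, ∃ q ∈ F, ∃ᶠ i in atTop, s i = q

/-- The timed language accepted by `C`. -/
def language (C : TimedAut L) : Set (TimedWord L) :=
  {ρ | ∃ (s : ℕ → C.Loc) (v : ℕ → C.Clock → ℝ), C.IsRun ρ s v ∧ C.IsAccepting s}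

end TimedAut

/-! ## The component automaton for `Ã_{≤ c}` -/

section Component

variable {P : Type u} {n : ℕ} (A : FinAut (Fin n)) (β : Fin n → BoolForm P) (c : ℕ)

/-- The universal successor relation between sets of locations of `A` on the letter `σ`: `T` is
a minimal set such that for each `s ∈ S` and each transition of `A` from `s` to some `s'` labelled
by `a`, either `s' ∈ T` or `σ ⊨ β a`. -/
def UnivStep (σ : Set P) (S T : Set A.Loc) : Prop :=
  Minimal (fun U : Set A.Loc =>
    ∀ s ∈ S, ∀ (a : Fin n) (s' : A.Loc), (s, a, s') ∈ A.trans → s' ∈ U ∨ (β a).Holds σ) T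

/-- The transitions of a sub-component, with clock `x`, for `p_ψ ∉ σ`. -/
inductive SubStep {X : Type} (x : X) (σ : Set P) :
    Set A.Loc → Guard X → Set X → Set A.Loc → Prop
  | idle : SubStep x σ ∅ .top ∅ ∅
  | step (S S' : Set A.Loc) : UnivStep A β σ S S' → S' ∩ A.final = ∅ →
      SubStep x σ S (.cmp x .le c) ∅ S'
  | clear (S : Set A.Loc) : SubStep x σ S (.cmp x .gt c) ∅ ∅

/-- The transitions of a sub-component, with clock `x`, for `p_ψ ∈ σ`. -/
inductive SubTrigger {X : Type} (x : X) (σ : Set P) :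
    Set A.Loc → Guard X → Set X → Set A.Loc → Prop
  | start (S' : Set A.Loc) : UnivStep A β σ {A.init} S' → S' ∩ A.final = ∅ →
      SubTrigger x σ ∅ .top {x} S'
  | merge (S S₁ S₂ : Set A.Loc) : UnivStep A β σ S S₁ → UnivStep A β σ {A.init} S₂ →
      (S₁ ∪ S₂) ∩ A.final = ∅ → SubTrigger x σ S (.cmp x .le c) {x} (S₁ ∪ S₂)
  | restart (S S' : Set A.Loc) : UnivStep A β σ {A.init} S' → S' ∩ A.final = ∅ →
      SubTrigger x σ S (.cmp x .gt c) {x} S'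

/-- The component automaton for `Ã_{≤ c}(β₁, …, βₙ)` with trigger `p`. With `m` the number of
locations of `A`, it has `m + 1` synchronised sub-components, each of which has its own clock.
If `p ∈ σ`, exactly one sub-component takes a trigger transition and the others proceed as if
`p ∉ σ`. -/
def dualLeComponent (p : P) : TimedAut (Set P) where
  Loc := Fin (Nat.card A.Loc + 1) → Set A.Loc
  finite_loc := by
    have := A.finite_loc
    infer_instance
  init := fun _ => ∅
  Clock := Fin (Nat.card A.Loc + 1)
  finite_clock := inferInstance
  trans := {t | ∃ (S S' : Fin (Nat.card A.Loc + 1) → Set A.Loc) (σ : Set P)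
      (g : Fin (Nat.card A.Loc + 1) → Guard (Fin (Nat.card A.Loc + 1)))
      (r : Fin (Nat.card A.Loc + 1) → Set (Fin (Nat.card A.Loc + 1))),
      t = (S, σ, Guard.conj (List.ofFn g), ⋃ j, r j, S') ∧
      ((p ∉ σ ∧ ∀ j, SubStep A β c j σ (S j) (g j) (r j) (S' j)) ∨
        (p ∈ σ ∧ ∃ k, SubTrigger A β c k σ (S k) (g k) (r k) (S' k) ∧
          ∀ j, j ≠ k → SubStep A β c j σ (S j) (g j) (r j) (S' j)))}
  final := ∅

end Component

end EMITLTA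

open EMITLTA

namespace EMITLTA

variable {P : Type u}

/-! ## Semantics of the Boolean and derived operators -/

/-! The relation `UnivStep` is deterministic: its only successor is the set `univSucc` of locations
reached by a transition whose formula fails. Hence the dual modality holds at `i` iff the set
started from the initial location at `i` meets no final location up to time `ρ.time i + c`
(`SafeUntil`, `sat_dualAut_iff`).

Every accepted word is correct because a trigger stores its obligation in some sub-component and
resets its clock. For `c` time units that clock cannot exceed `c`, so the obligation is never
dropped, and every such step avoids final locations (`safeUntil_of_mem_language`).

Conversely, a run is built that keeps `RunInvariant`: of two active sub-components, at least one is
not safe until the deadline of the other. Each active set has a member that becomes unsafe as early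
as the set does, and by the invariant these members are distinct; so at most `m` of the `m + 1`
sub-components are active. A trigger is merged into an active set that stays safe until the new
deadline, if there is one, and otherwise goes to an inactive sub-component
(`RunInvariant.exists_trigger`). Either way no other active set is safe until the new deadline,
which preserves the invariant. -/

theorem BoolForm.sat_toEMITL (β : BoolForm P) (ρ : TimedWord (Set P)) (i : ℕ) :
    β.toEMITL.Sat ρ i ↔ β.Holds (ρ.letter i) := by
  induction β with
  | top => simp [BoolForm.toEMITL, EMITL.Sat, BoolForm.Holds]
  | bot => simp [BoolForm.toEMITL, EMITL.bot, EMITL.Sat, BoolForm.Holds]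
  | atom p => simp [BoolForm.toEMITL, EMITL.Sat, BoolForm.Holds]
  | natom p => simp [BoolForm.toEMITL, EMITL.Sat, BoolForm.Holds]
  | and β₁ β₂ h₁ h₂ => simp [BoolForm.toEMITL, EMITL.Sat, BoolForm.Holds, h₁, h₂]
  | or β₁ β₂ h₁ h₂ =>
    simp only [BoolForm.toEMITL, EMITL.or, EMITL.Sat, BoolForm.Holds, h₁, h₂]
    tauto

theorem EMITL.sat_imp (φ χ : EMITL P) (ρ : TimedWord (Set P)) (i : ℕ) :
    (φ.imp χ).Sat ρ i ↔ (φ.Sat ρ i → χ.Sat ρ i) := by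
  simp only [EMITL.imp, EMITL.or, EMITL.Sat]
  tauto

theorem EMITL.sat_eventually_zero (φ : EMITL P) (ρ : TimedWord (Set P)) :
    φ.eventually.Sat ρ 0 ↔ ∃ j, φ.Sat ρ j := by
  simp only [EMITL.eventually, EMITL.until_, EMITL.Sat]
  constructor
  · rintro ⟨j, -, -, w, hw, ⟨-, r, -, hr, hf⟩, hs⟩
    have hj : j < w.length := by omega
    have ht := hr j hj
    -- The last step enters the final location `true`, and only the letter `1` leads there.
    have hl : r (j + 1) = true := by
      have : r w.length = true := hf
      rwa [show w.length = j + 1 by omega] at this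
    rw [hl] at ht
    have h1 : w[j] = 1 := by
      rcases ht with h | h
      · cases congrArg (fun x => x.2.2) h
      · exact congrArg (fun x => x.2.1) h
    have := hs j hj
    rw [h1] at this
    exact ⟨0 + j, this⟩
  · rintro ⟨j, hj⟩
    refine ⟨j, Nat.zero_le _, ?_, List.replicate j 0 ++ [1], by simp, ⟨by simp,
      fun k => decide (j < k), ?_, ?_, ?_⟩, ?_⟩
    · simpa [TimeInterval.toSet] using ρ.time_mono (Nat.zero_le j)
    · simp [untilAut]
    · intro k hk
      simp only [List.length_append, List.length_replicate, List.length_singleton] at hk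
      rcases (Nat.lt_succ_iff.1 hk).lt_or_eq with h | rfl
      · have h₁ : ¬ j < k := by omega
        have h₂ : ¬ j < k + 1 := by omega
        simp [h, h₁, h₂, untilAut]
        exact Or.inl rfl
      · simp [untilAut]
        exact Or.inr rfl
    · simp [untilAut]
      rfl
    · intro k hk
      simp only [List.length_append, List.length_replicate, List.length_singleton] at hk
      rcases (Nat.lt_succ_iff.1 hk).lt_or_eq with h | rfl
      · simp [h, EMITL.Sat]
      · simpa [List.getElem_append] using hj

theorem EMITL.sat_globally_zero (φ : EMITL P) (ρ : TimedWord (Set P)) :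
    φ.globally.Sat ρ 0 ↔ ∀ j, φ.Sat ρ j := by
  have := EMITL.sat_eventually_zero φ.neg ρ
  simp only [EMITL.globally, EMITL.Sat] at this ⊢
  rw [this]
  simp

/-! ## Universal successors -/

section

variable {n : ℕ} (A : FinAut (Fin n)) (β : Fin n → BoolForm P)

/-- The locations that are reached from `S` by a transition whose formula fails on `σ`. -/
def univSucc (σ : Set P) (S : Set A.Loc) : Set A.Loc :=
  {s' | ∃ s ∈ S, ∃ a, (s, a, s') ∈ A.trans ∧ ¬ (β a).Holds σ}

variable {A β} in
-- The sets allowed as successors are exactly the supersets of `univSucc`, so a minimal one is the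
-- least one.
theorem univStep_iff {σ : Set P} {S T : Set A.Loc} :
    UnivStep A β σ S T ↔ T = univSucc A β σ S := by
  have key : ∀ U : Set A.Loc, (∀ s ∈ S, ∀ (a : Fin n) (s' : A.Loc), (s, a, s') ∈ A.trans →
      s' ∈ U ∨ (β a).Holds σ) ↔ univSucc A β σ S ≤ U := by
    intro U
    constructor
    · rintro h s' ⟨s, hs, a, ha, hn⟩
      exact (h s hs a s' ha).resolve_right hn
    · intro h s hs a s' ha
      by_cases hn : (β a).Holds σ
      · exact Or.inr hn
      · exact Or.inl (h ⟨s, hs, a, ha, hn⟩)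
  simp only [UnivStep, key]
  constructor
  · exact fun h => (h.2 le_rfl h.1).antisymm h.1
  · rintro rfl
    exact ⟨le_rfl, fun _ h _ => h⟩

theorem univSucc_empty (σ : Set P) : univSucc A β σ ∅ = ∅ := by
  simp [univSucc]

theorem univSucc_union (σ : Set P) (S T : Set A.Loc) :
    univSucc A β σ (S ∪ T) = univSucc A β σ S ∪ univSucc A β σ T := by
  ext s'
  simp only [univSucc, mem_union, mem_ofPred_eq]
  constructor
  · rintro ⟨s, hs | hs, h⟩
    · exact Or.inl ⟨s, hs, h⟩
    · exact Or.inr ⟨s, hs, h⟩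
  · rintro (⟨s, hs, h⟩ | ⟨s, hs, h⟩)
    · exact ⟨s, Or.inl hs, h⟩
    · exact ⟨s, Or.inr hs, h⟩

theorem univSucc_mono (σ : Set P) {S T : Set A.Loc} (h : S ⊆ T) :
    univSucc A β σ S ⊆ univSucc A β σ T := by
  rintro s' ⟨s, hs, h'⟩
  exact ⟨s, h hs, h'⟩

/-! ### Sets reached along a timed word, and safety up to a time bound -/

variable (ρ : TimedWord (Set P))

/-- The locations reached from `S` after reading `k` letters of `ρ`, starting with the letter of
index `i`. -/
def reachSet (i : ℕ) (S : Set A.Loc) : ℕ → Set A.Loc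
  | 0 => S
  | k + 1 => univSucc A β (ρ.letter (i + k)) (reachSet i S k)

/-- `reachSet` unfolds at the last letter, whereas a step of the automaton consumes the first one.
-/
theorem reachSet_univSucc (i : ℕ) (S : Set A.Loc) (k : ℕ) :
    reachSet A β ρ (i + 1) (univSucc A β (ρ.letter i) S) k = reachSet A β ρ i S (k + 1) := by
  induction k with
  | zero => rfl
  | succ k ih =>
    rw [reachSet, ih, Nat.add_right_comm, Nat.add_assoc]
    rfl

theorem reachSet_union (i : ℕ) (S T : Set A.Loc) (k : ℕ) :
    reachSet A β ρ i (S ∪ T) k = reachSet A β ρ i S k ∪ reachSet A β ρ i T k := by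
  induction k with
  | zero => rfl
  | succ k ih => rw [reachSet, ih, univSucc_union, reachSet, reachSet]

theorem reachSet_empty (i k : ℕ) : reachSet A β ρ i ∅ k = ∅ := by
  induction k with
  | zero => rfl
  | succ k ih => rw [reachSet, ih, univSucc_empty]

theorem exists_mem_reachSet_singleton {i k : ℕ} {S : Set A.Loc} {s : A.Loc}
    (hs : s ∈ reachSet A β ρ i S k) : ∃ q ∈ S, s ∈ reachSet A β ρ i {q} k := by
  induction k generalizing s with
  | zero => exact ⟨s, hs, rfl⟩
  | succ k ih =>
    obtain ⟨s₁, h₁, h⟩ := hs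
    obtain ⟨q, hq, hq'⟩ := ih h₁
    exact ⟨q, hq, s₁, hq', h⟩

/-- Links the subset construction to the words and runs in the semantics of the automata modality
applied to negated arguments. -/
theorem mem_reachSet_init_iff (i k : ℕ) (s : A.Loc) :
    s ∈ reachSet A β ρ i {A.init} k ↔ ∃ (w : List (Fin n)) (r : ℕ → A.Loc), w.length = k ∧
      r 0 = A.init ∧ (∀ (l : ℕ) (hl : l < w.length), (r l, w[l], r (l + 1)) ∈ A.trans) ∧
      r k = s ∧ ∀ (l : ℕ) (hl : l < w.length), ¬ (β w[l]).Holds (ρ.letter (i + l)) := by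
  induction k generalizing s with
  | zero =>
    constructor
    · rintro rfl
      exact ⟨[], fun _ => A.init, rfl, rfl, by simp, rfl, by simp⟩
    · rintro ⟨w, r, -, h0, -, hs, -⟩
      exact hs.symm.trans h0
  | succ k ih =>
    constructor
    · rintro ⟨s₁, h₁, a, ha, hn⟩
      obtain ⟨w, r, hw, h0, ht, hk, hh⟩ := (ih s₁).1 h₁
      refine ⟨w ++ [a], Function.update r (k + 1) s, by simp [hw], by simp [h0], ?_, by simp, ?_⟩
      · intro l hl
        simp only [List.length_append, List.length_singleton, hw] at hl
        rcases (Nat.lt_succ_iff.1 hl).lt_or_eq with h | rfl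
        · have h' : l < w.length := by omega
          rw [Function.update_of_ne (by omega), Function.update_of_ne (by omega),
            List.getElem_append_left h']
          exact ht l h'
        · subst hw
          simpa [hk] using ha
      · intro l hl
        simp only [List.length_append, List.length_singleton, hw] at hl
        rcases (Nat.lt_succ_iff.1 hl).lt_or_eq with h | rfl
        · have h' : l < w.length := by omega
          rw [List.getElem_append_left h']
          exact hh l h'
        · subst hw
          simpa using hn
    · rintro ⟨w, r, hw, h0, ht, hk, hh⟩
      refine ⟨r k, (ih (r k)).2 ⟨w.take k, r, by simp [hw], h0, ?_, rfl, ?_⟩, w[k], ?_,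
        hh k (by omega)⟩
      · intro l hl
        rw [List.getElem_take]
        exact ht l _
      · intro l hl
        rw [List.getElem_take]
        exact hh l _
      · rw [← hk]
        exact ht k (by omega)

/-- No final location is reached from `S` by reading the letters with timestamp at most `b`,
starting with the letter of index `i`. -/
def SafeUntil (i : ℕ) (S : Set A.Loc) (b : ℝ) : Prop :=
  ∀ k, ρ.time (i + k) ≤ b → reachSet A β ρ i S (k + 1) ∩ A.final = ∅

theorem sat_dualAut_iff (c i : ℕ) :
    (EMITL.dualAut A (.icc 0 c) fun a => (β a).toEMITL).Sat ρ i ↔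
      SafeUntil A β ρ i {A.init} (ρ.time i + c) := by
  simp only [EMITL.dualAut, EMITL.Sat, BoolForm.sat_toEMITL, SafeUntil, TimeInterval.toSet]
  constructor
  · intro h k hk
    by_contra hne
    obtain ⟨s, hs, hf⟩ := nonempty_iff_ne_empty.2 hne
    obtain ⟨w, r, hw, h0, ht, hl, hh⟩ := (mem_reachSet_init_iff A β ρ i (k + 1) s).1 hs
    refine h ⟨i + k, by omega, ⟨?_, by linarith⟩, w, by omega, ⟨?_, r, h0, ht, ?_⟩, hh⟩
    · have := ρ.time_mono (Nat.le_add_right i k)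
      push_cast
      linarith
    · rintro rfl
      simp at hw
    · rwa [hw, hl]
  · rintro h ⟨j, hj, ht, w, hw, ⟨-, r, h0, hr, hf⟩, hh⟩
    obtain ⟨k, rfl⟩ := Nat.exists_eq_add_of_le hj
    have hk : w.length = k + 1 := by omega
    rw [hk] at hf
    have hs := (mem_reachSet_init_iff A β ρ i (k + 1) (r (k + 1))).2 ⟨w, r, hk, h0, hr, rfl, hh⟩
    have := h k (by linarith [ht.2])
    exact (this ▸ (⟨hs, hf⟩ : r (k + 1) ∈ reachSet A β ρ i {A.init} (k + 1) ∩ A.final) :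
      r (k + 1) ∈ (∅ : Set A.Loc))

section

variable {A β ρ}

theorem SafeUntil.mono {i : ℕ} {S : Set A.Loc} {b b' : ℝ} (h : SafeUntil A β ρ i S b)
    (hb : b' ≤ b) : SafeUntil A β ρ i S b' :=
  fun k hk => h k (hk.trans hb)

theorem SafeUntil.succ_inter_final {i : ℕ} {S : Set A.Loc} {b : ℝ}
    (h : SafeUntil A β ρ i S b) (hb : ρ.time i ≤ b) :
    univSucc A β (ρ.letter i) S ∩ A.final = ∅ :=
  h 0 hb

theorem SafeUntil.succ {i : ℕ} {S : Set A.Loc} {b : ℝ} (h : SafeUntil A β ρ i S b) :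
    SafeUntil A β ρ (i + 1) (univSucc A β (ρ.letter i) S) b := by
  intro k hk
  rw [reachSet_univSucc]
  exact h (k + 1) (by rwa [show i + (k + 1) = i + 1 + k by omega])

theorem SafeUntil.of_succ {i : ℕ} {S : Set A.Loc} {b : ℝ}
    (h₀ : univSucc A β (ρ.letter i) S ∩ A.final = ∅)
    (h : SafeUntil A β ρ (i + 1) (univSucc A β (ρ.letter i) S) b) : SafeUntil A β ρ i S b := by
  intro k hk
  cases k with
  | zero => exact h₀
  | succ k =>
    rw [← reachSet_univSucc]
    exact h k (by rwa [show i + 1 + k = i + (k + 1) by omega])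

theorem SafeUntil.union {i : ℕ} {S T : Set A.Loc} {b : ℝ} (h : SafeUntil A β ρ i S b)
    (h' : SafeUntil A β ρ i T b) : SafeUntil A β ρ i (S ∪ T) b := by
  intro k hk
  rw [reachSet_union, union_inter_distrib_right, h k hk, h' k hk, union_empty]

theorem safeUntil_empty {i : ℕ} {b : ℝ} : SafeUntil A β ρ i ∅ b := by
  intro k _
  rw [reachSet_empty, empty_inter]

variable (β ρ) in
/-- A nonempty set of locations has a member that is unsafe as early as the set is. -/
theorem exists_safeUntil_of_singleton (i : ℕ) {S : Set A.Loc} (hS : S.Nonempty) :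
    ∃ s ∈ S, ∀ b, SafeUntil A β ρ i {s} b → SafeUntil A β ρ i S b := by
  classical
  -- Take the earliest visit to a final location and the origin in `S` of a path to it. If there is
  -- no visit, `S` is always safe and any member serves.
  by_cases h : ∃ k, (reachSet A β ρ i S (k + 1) ∩ A.final).Nonempty
  · obtain ⟨s', hs', hf⟩ := Nat.find_spec h
    obtain ⟨s, hs, hr⟩ := exists_mem_reachSet_singleton A β ρ hs'
    refine ⟨s, hs, fun b hb k hk => ?_⟩
    by_contra hne
    have hle := Nat.find_min' h (nonempty_iff_ne_empty.2 hne)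
    have := hb (Nat.find h) ((ρ.time_mono (Nat.add_le_add_left hle i)).trans hk)
    exact Set.eq_empty_iff_forall_notMem.1 this s' ⟨hr, hf⟩
  · push Not at h
    obtain ⟨s, hs⟩ := hS
    exact ⟨s, hs, fun b _ k _ => h k⟩

end

/-! ## Runs of the component automaton -/

theorem Guard.sat_conj_ofFn {X : Type} {m : ℕ} (g : Fin m → Guard X) (v : X → ℝ) :
    (Guard.conj (List.ofFn g)).Sat v ↔ ∀ j, (g j).Sat v := by
  have key : ∀ l : List (Guard X), (Guard.conj l).Sat v ↔ ∀ x ∈ l, x.Sat v := by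
    intro l
    induction l with
    | nil => simp [Guard.conj, Guard.Sat]
    | cons x l ih =>
      rw [List.forall_mem_cons, ← ih]
      rfl
  rw [key]
  simp [List.mem_ofFn]

variable {A β} {c : ℕ} {X : Type} {x : X} {σ : Set P} {S S' : Set A.Loc} {g : Guard X}
  {r : Set X} {v : X → ℝ}

theorem SubStep.eq_univSucc (h : SubStep A β c x σ S g r S') (hg : g.Sat v) (hv : v x ≤ c) :
    S' = univSucc A β σ S ∧ S' ∩ A.final = ∅ := by
  cases h with
  | idle => exact ⟨(univSucc_empty A β σ).symm, empty_inter _⟩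
  | step _ _ h h' => exact ⟨univStep_iff.1 h, h'⟩
  | clear => exact absurd hv (not_le.2 hg)

theorem SubTrigger.reset_eq (h : SubTrigger A β c x σ S g r S') : r = {x} := by
  cases h <;> rfl

theorem SubTrigger.inter_final (h : SubTrigger A β c x σ S g r S') : S' ∩ A.final = ∅ := by
  cases h <;> assumption

theorem SubTrigger.univSucc_init_subset (h : SubTrigger A β c x σ S g r S') :
    univSucc A β σ {A.init} ⊆ S' := by
  cases h with
  | start _ h => exact (univStep_iff.1 h).ge
  | merge _ _ _ _ h => exact (univStep_iff.1 h).ge.trans subset_union_right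
  | restart _ _ h => exact (univStep_iff.1 h).ge

theorem SubTrigger.univSucc_subset (h : SubTrigger A β c x σ S g r S') (hg : g.Sat v)
    (hv : v x ≤ c) : univSucc A β σ S ⊆ S' := by
  cases h with
  | start => simp [univSucc_empty]
  | merge _ _ _ h => exact (univStep_iff.1 h).ge.trans subset_union_left
  | restart => exact absurd hv (not_le.2 hg)

variable {ρ} {p : P}

/-- A clock value of at most `c` rules out `clear` and `restart`, the only transitions that lose
obligations. There is only an inclusion because `merge` may add locations. -/
theorem component_step {s : ℕ → Fin (Nat.card A.Loc + 1) → Set A.Loc}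
    {v : ℕ → Fin (Nat.card A.Loc + 1) → ℝ} (h : (dualLeComponent A β c p).IsRun ρ s v) (i : ℕ)
    (k : Fin (Nat.card A.Loc + 1)) (hv : v i k + ρ.delay i ≤ c) :
    univSucc A β (ρ.letter i) (s i k) ⊆ s (i + 1) k ∧ s (i + 1) k ∩ A.final = ∅ ∧
      (v (i + 1) k = 0 ∨ v (i + 1) k = v i k + ρ.delay i) := by
  obtain ⟨g, r, ⟨S, S', σ, g', r', he, hstep⟩, hg, hr⟩ := h.2.2 i
  obtain ⟨e₁, he⟩ := Prod.mk.inj he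
  obtain ⟨e₂, he⟩ := Prod.mk.inj he
  obtain ⟨e₃, he⟩ := Prod.mk.inj he
  obtain ⟨e₄, e₅⟩ := Prod.mk.inj he
  subst e₁ e₂ e₃ e₄ e₅
  have hg' := (Guard.sat_conj_ofFn g' _).1 hg
  refine and_assoc.1 ⟨?_, ?_⟩
  · have sub : ∀ j, SubStep A β c j (ρ.letter i) (s i j) (g' j) (r' j) (s (i + 1) j) → j = k →
        univSucc A β (ρ.letter i) (s i k) ⊆ s (i + 1) k ∧ s (i + 1) k ∩ A.final = ∅ := by
      rintro j hj rfl
      obtain ⟨h₁, h₂⟩ := hj.eq_univSucc (hg' j) hv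
      exact ⟨h₁.ge, h₂⟩
    rcases hstep with ⟨-, hs⟩ | ⟨-, l, hl, hs⟩
    · exact sub k (hs k) rfl
    · by_cases hkl : k = l
      · subst hkl
        exact ⟨hl.univSucc_subset (hg' k) hv, hl.inter_final⟩
      · exact sub k (hs k hkl) rfl
  · rw [hr]
    unfold TimedAut.reset
    dsimp only
    split_ifs
    · exact Or.inl rfl
    · exact Or.inr rfl

theorem component_trigger {s : ℕ → Fin (Nat.card A.Loc + 1) → Set A.Loc}
    {v : ℕ → Fin (Nat.card A.Loc + 1) → ℝ} (h : (dualLeComponent A β c p).IsRun ρ s v) (i : ℕ)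
    (hp : p ∈ ρ.letter i) : ∃ k, univSucc A β (ρ.letter i) {A.init} ⊆ s (i + 1) k ∧
      s (i + 1) k ∩ A.final = ∅ ∧ v (i + 1) k = 0 := by
  obtain ⟨g, r, ⟨S, S', σ, g', r', he, hstep⟩, hg, hr⟩ := h.2.2 i
  obtain ⟨e₁, he⟩ := Prod.mk.inj he
  obtain ⟨e₂, he⟩ := Prod.mk.inj he
  obtain ⟨e₃, he⟩ := Prod.mk.inj he
  obtain ⟨e₄, e₅⟩ := Prod.mk.inj he
  subst e₁ e₂ e₃ e₄ e₅
  obtain ⟨k, hk, -⟩ := (hstep.resolve_left fun h => h.1 hp).2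
  refine ⟨k, hk.univSucc_init_subset, hk.inter_final, ?_⟩
  rw [hr]
  have : k ∈ ⋃ j, r' j := mem_iUnion.2 ⟨k, by rw [hk.reset_eq]; rfl⟩
  exact if_pos this

theorem safeUntil_of_mem_language (h : ρ ∈ (dualLeComponent A β c p).language) (i : ℕ)
    (hp : p ∈ ρ.letter i) : SafeUntil A β ρ i {A.init} (ρ.time i + c) := by
  obtain ⟨s, v, hrun, -⟩ := h
  obtain ⟨k, h₁, h₂, h₃⟩ := component_trigger hrun i hp
  -- The clock is bounded by the time since `i`, not equal to it: later triggers may reset it, which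
  -- only makes the sub-component keep its obligations longer.
  have key : ∀ d, ρ.time (i + d) ≤ ρ.time i + c →
      reachSet A β ρ i {A.init} (d + 1) ⊆ s (i + d + 1) k ∧ s (i + d + 1) k ∩ A.final = ∅ ∧
        v (i + d + 1) k ≤ ρ.time (i + d) - ρ.time i := by
    intro d
    induction d with
    | zero => exact fun _ => ⟨h₁, h₂, by simp [h₃]⟩
    | succ d ih =>
      intro hd
      have hm : ρ.time (i + d) ≤ ρ.time (i + d + 1) := ρ.time_mono (Nat.le_succ _)
      have hi : ρ.time i ≤ ρ.time (i + d + 1) := ρ.time_mono (by omega)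
      have hd' : ρ.time (i + d + 1) ≤ ρ.time i + c := hd
      obtain ⟨a₁, -, a₃⟩ := ih (hm.trans hd')
      have hdel : ρ.delay (i + d + 1) = ρ.time (i + d + 1) - ρ.time (i + d) := rfl
      obtain ⟨b₁, b₂, b₃⟩ := component_step hrun (i + d + 1) k (by linarith)
      refine ⟨(univSucc_mono A β _ a₁).trans b₁, b₂, ?_⟩
      change v (i + d + 1 + 1) k ≤ ρ.time (i + d + 1) - ρ.time i
      rcases b₃ with b | b <;> linarith
  intro d hd
  obtain ⟨a₁, a₂, -⟩ := key d hd
  exact subset_empty_iff.1 (a₂ ▸ inter_subset_inter_left _ a₁)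

/-! ## Construction of a run -/

/-- The timestamp of the event before the event of index `i`, or the origin of time. -/
def TimedWord.prevTime {L : Type u} (ρ : TimedWord L) : ℕ → ℝ
  | 0 => 0
  | i + 1 => ρ.time i

theorem TimedWord.delay_eq {L : Type u} (ρ : TimedWord L) (i : ℕ) :
    ρ.delay i = ρ.time i - ρ.prevTime i := by
  cases i <;> simp [TimedWord.delay, TimedWord.prevTime]

theorem TimedWord.prevTime_le {L : Type u} (ρ : TimedWord L) (i : ℕ) :
    ρ.prevTime i ≤ ρ.time i := by
  cases i with
  | zero => exact ρ.time_nonneg 0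
  | succ i => exact ρ.time_mono (Nat.le_succ i)

variable (A β c ρ) in
/-- Invariant of the constructed run before the event of index `i`, for the sets `S` of the
sub-components and the times `t` of their last resets: each sub-component is safe until it
expires, and of two active ones at least one could not have been kept until the expiry of the
other. -/
structure RunInvariant (i : ℕ) {K : Type} (S : K → Set A.Loc) (t : K → ℝ) : Prop where
  le_prevTime : ∀ k, t k ≤ ρ.prevTime i
  safe : ∀ k, SafeUntil A β ρ i (S k) (t k + c)
  incompatible : ∀ k l, k ≠ l → (S k).Nonempty → (S l).Nonempty → ρ.time i ≤ t k + c →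
    ρ.time i ≤ t l + c →
    ¬ (SafeUntil A β ρ i (S k) (t l + c) ∧ SafeUntil A β ρ i (S l) (t k + c))

/-- Pigeonhole: if all `m + 1` sub-components were active, their earliest-unsafe members would be `m
+ 1` distinct locations of `A`. -/
theorem RunInvariant.exists_inactive {i : ℕ} {S : Fin (Nat.card A.Loc + 1) → Set A.Loc}
    {t : Fin (Nat.card A.Loc + 1) → ℝ} (h : RunInvariant A β ρ c i S t) :
    ∃ k, S k = ∅ ∨ t k + c < ρ.time i := by
  by_contra! hne
  choose f hf hf' using fun k => exists_safeUntil_of_singleton β ρ i (hne k).1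
  have : Finite A.Loc := A.finite_loc
  have hinj : Function.Injective f := by
    intro k l hkl
    by_contra hk
    refine h.incompatible k l hk (hne k).1 (hne l).1 (hne k).2 (hne l).2
      ⟨hf' k _ ?_, hf' l _ ?_⟩
    -- The common member lies in `S l`, so it is safe until the deadline of `l`; by its choice in `S
    -- k`, so is all of `S k`.
    · rw [hkl]
      intro d hd
      have := h.safe l d hd
      refine subset_empty_iff.1 (this ▸ inter_subset_inter_left _ ?_)
      rw [← union_eq_self_of_subset_left (singleton_subset_iff.2 (hf l)), reachSet_union]
      exact subset_union_left
    · rw [← hkl]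
      intro d hd
      have := h.safe k d hd
      refine subset_empty_iff.1 (this ▸ inter_subset_inter_left _ ?_)
      rw [← union_eq_self_of_subset_left (singleton_subset_iff.2 (hf k)), reachSet_union]
      exact subset_union_left
  have := Nat.card_le_card_of_injective f hinj
  simp at this

/-- A sub-component can be chosen for a trigger: it is free, or its set can be kept for another
`c` time units, and no other active sub-component can be kept that long. -/
theorem RunInvariant.exists_trigger {i : ℕ} {S : Fin (Nat.card A.Loc + 1) → Set A.Loc}
    {t : Fin (Nat.card A.Loc + 1) → ℝ} (h : RunInvariant A β ρ c i S t) :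
    ∃ k, ((S k = ∅ ∨ t k + c < ρ.time i) ∨ SafeUntil A β ρ i (S k) (ρ.time i + c)) ∧
      ∀ l, l ≠ k → (S l).Nonempty → ρ.time i ≤ t l + c →
        ¬ SafeUntil A β ρ i (S l) (ρ.time i + c) := by
  have ht : ∀ l, t l + c ≤ ρ.time i + c := fun l => by
    linarith [h.le_prevTime l, ρ.prevTime_le i]
  by_cases hm : ∃ k, (S k).Nonempty ∧ ρ.time i ≤ t k + c ∧
      SafeUntil A β ρ i (S k) (ρ.time i + c)
  · obtain ⟨k, h₁, h₂, h₃⟩ := hm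
    -- The new deadline is the latest, so two active sets safe until then would also be safe until
    -- each other's deadlines.
    exact ⟨k, Or.inr h₃, fun l hl h₁' h₂' h₃' => h.incompatible l k hl h₁' h₁ h₂' h₂
      ⟨h₃'.mono (ht k), h₃.mono (ht l)⟩⟩
  · obtain ⟨k, hk⟩ := h.exists_inactive
    exact ⟨k, Or.inl hk, fun l _ h₁ h₂ h₃ => hm ⟨l, h₁, h₂, h₃⟩⟩

open Classical in
variable (A β c) in
/-- The successor of a sub-component that is not triggered. -/
noncomputable def nextSet (σ : Set P) (S : Set A.Loc) (y : ℝ) : Set A.Loc :=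
  if y ≤ c then univSucc A β σ S else ∅

theorem exists_subStep {i : ℕ} {y : ℝ} (h : SafeUntil A β ρ i S (y + c)) (x : X)
    (v : X → ℝ) (hv : v x = ρ.time i - y) :
    ∃ g, SubStep A β c x (ρ.letter i) S g ∅ (nextSet A β c (ρ.letter i) S (ρ.time i - y)) ∧
      g.Sat v := by
  unfold nextSet
  split_ifs with hy
  -- `idle` is not needed: `step` also covers the empty set, whose successor is empty.
  · exact ⟨_, .step _ _ (univStep_iff.2 rfl) (h.succ_inter_final (by linarith)),
      show v x ≤ c from hv ▸ hy⟩
  · exact ⟨_, .clear _, show v x > c from hv ▸ not_le.1 hy⟩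

/-- An expired clock forces `restart`; otherwise an empty set takes `start`, and a nonempty one is
active, hence safe until the new deadline and fit for `merge`. -/
theorem exists_subTrigger {i : ℕ} {y : ℝ}
    (hi : SafeUntil A β ρ i {A.init} (ρ.time i + c))
    (h : (S = ∅ ∨ y + c < ρ.time i) ∨ SafeUntil A β ρ i S (ρ.time i + c)) (x : X)
    (v : X → ℝ) (hv : v x = ρ.time i - y) :
    ∃ g S', SubTrigger A β c x (ρ.letter i) S g {x} S' ∧ g.Sat v ∧
      SafeUntil A β ρ (i + 1) S' (ρ.time i + c) := by
  have hc : ρ.time i ≤ ρ.time i + c := by simp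
  by_cases hy : v x ≤ c
  · by_cases hS : S = ∅
    · subst hS
      exact ⟨_, _, .start _ (univStep_iff.2 rfl) (hi.succ_inter_final hc), trivial, hi.succ⟩
    · have h' : SafeUntil A β ρ i S (ρ.time i + c) :=
        h.resolve_left (not_or.2 ⟨hS, by linarith⟩)
      refine ⟨_, _, .merge _ _ _ (univStep_iff.2 rfl) (univStep_iff.2 rfl) ?_, hy,
        h'.succ.union hi.succ⟩
      rw [← univSucc_union]
      exact (h'.union hi).succ_inter_final hc
  · exact ⟨_, _, .restart _ _ (univStep_iff.2 rfl) (hi.succ_inter_final hc), not_le.1 hy,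
      hi.succ⟩

section

variable {i : ℕ} {K : Type} {S : K → Set A.Loc} {t : K → ℝ}

theorem RunInvariant.safe_nextSet (h : RunInvariant A β ρ c i S t) (k : K) :
    SafeUntil A β ρ (i + 1) (nextSet A β c (ρ.letter i) (S k) (ρ.time i - t k)) (t k + c) := by
  unfold nextSet
  split_ifs
  · exact (h.safe k).succ
  · exact safeUntil_empty

/-- A sub-component that is nonempty after an untriggered step was active, and its safety was not
changed by the step. -/
theorem RunInvariant.of_nextSet_nonempty (h : RunInvariant A β ρ c i S t) {k : K}
    (hk : (nextSet A β c (ρ.letter i) (S k) (ρ.time i - t k)).Nonempty) :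
    (S k).Nonempty ∧ ρ.time i ≤ t k + c ∧ ∀ b,
      SafeUntil A β ρ (i + 1) (nextSet A β c (ρ.letter i) (S k) (ρ.time i - t k)) b →
        SafeUntil A β ρ i (S k) b := by
  unfold nextSet at hk ⊢
  split_ifs at hk ⊢ with hy
  · have hy' : ρ.time i ≤ t k + c := by linarith
    refine ⟨?_, hy', fun b hb => hb.of_succ ((h.safe k).succ_inter_final hy')⟩
    obtain ⟨_, s, hs, -⟩ := hk
    exact ⟨s, hs⟩
  · exact absurd hk not_nonempty_empty

/-- Deadlines do not move, and safety of the successors pulls back to the previous sets, so a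
compatible pair would have been compatible before. -/
theorem RunInvariant.untriggered (h : RunInvariant A β ρ c i S t) :
    RunInvariant A β ρ c (i + 1)
      (fun k => nextSet A β c (ρ.letter i) (S k) (ρ.time i - t k)) t where
  le_prevTime k := (h.le_prevTime k).trans (ρ.prevTime_le i)
  safe := h.safe_nextSet
  incompatible := by
    rintro k l hkl hk hl - - ⟨h₁, h₂⟩
    obtain ⟨a₁, a₂, a₃⟩ := h.of_nextSet_nonempty hk
    obtain ⟨b₁, b₂, b₃⟩ := h.of_nextSet_nonempty hl
    exact h.incompatible k l hkl a₁ b₁ a₂ b₂ ⟨a₃ _ h₁, b₃ _ h₂⟩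

/-- Pairs containing `k₀` are incompatible since no other active set lasts until the new deadline;
the remaining pairs behave as in an untriggered step. -/
theorem RunInvariant.triggered [DecidableEq K] (h : RunInvariant A β ρ c i S t) (k₀ : K)
    {T : Set A.Loc} (hT : SafeUntil A β ρ (i + 1) T (ρ.time i + c))
    (hk₀ : ∀ l, l ≠ k₀ → (S l).Nonempty → ρ.time i ≤ t l + c →
      ¬ SafeUntil A β ρ i (S l) (ρ.time i + c)) :
    RunInvariant A β ρ c (i + 1)
      (Function.update (fun k => nextSet A β c (ρ.letter i) (S k) (ρ.time i - t k)) k₀ T)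
      (Function.update t k₀ (ρ.time i)) where
  le_prevTime k := by
    by_cases hk : k = k₀
    · subst hk
      simp [TimedWord.prevTime]
    · simpa [hk] using h.untriggered.le_prevTime k
  safe k := by
    by_cases hk : k = k₀
    · subst hk
      simpa using hT
    · simpa [hk] using h.safe_nextSet k
  incompatible := by
    have key : ∀ l, l ≠ k₀ → (nextSet A β c (ρ.letter i) (S l) (ρ.time i - t l)).Nonempty →
        ¬ SafeUntil A β ρ (i + 1) (nextSet A β c (ρ.letter i) (S l) (ρ.time i - t l))
          (ρ.time i + c) := by
      intro l hl hne hs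
      obtain ⟨a₁, a₂, a₃⟩ := h.of_nextSet_nonempty hne
      exact hk₀ l hl a₁ a₂ (a₃ _ hs)
    intro k l hkl
    by_cases hk : k = k₀
    · subst hk
      simp only [Function.update_self, Function.update_of_ne hkl.symm]
      exact fun _ hl _ _ hs => key l hkl.symm hl hs.2
    · by_cases hl : l = k₀
      · subst hl
        simp only [Function.update_self, Function.update_of_ne hkl]
        exact fun hk' _ _ _ hs => key k hkl hk' hs.1
      · simp only [Function.update_of_ne hk, Function.update_of_ne hl]
        exact h.untriggered.incompatible k l hkl

end

/-- The invariant allows a transition to states that satisfy the invariant again. -/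
theorem RunInvariant.exists_step {i : ℕ} {S : Fin (Nat.card A.Loc + 1) → Set A.Loc}
    {t : Fin (Nat.card A.Loc + 1) → ℝ} (h : RunInvariant A β ρ c i S t)
    (hp : p ∈ ρ.letter i → SafeUntil A β ρ i {A.init} (ρ.time i + c)) :
    ∃ S' t', RunInvariant A β ρ c (i + 1) S' t' ∧
      ∃ (g : Guard (Fin (Nat.card A.Loc + 1))) (r : Set (Fin (Nat.card A.Loc + 1))),
        (S, ρ.letter i, g, r, S') ∈ (dualLeComponent A β c p).trans ∧
        g.Sat (fun k => ρ.time i - t k) ∧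
        (fun k => ρ.time i - t' k) = TimedAut.reset (fun k => ρ.time i - t k) r := by
  -- Untriggered moves are chosen for all sub-components; a trigger overwrites one of them.
  choose g hg hg' using fun k => exists_subStep (h.safe k) k (fun k => ρ.time i - t k) rfl
  by_cases hpi : p ∈ ρ.letter i
  · obtain ⟨k, hk, hl⟩ := h.exists_trigger
    obtain ⟨g₀, T, hT, hg₀, hsafe⟩ :=
      exists_subTrigger (hp hpi) hk k (fun k => ρ.time i - t k) rfl
    refine ⟨_, _, h.triggered k hsafe hl, _, _,
      ⟨S, _, ρ.letter i, Function.update g k g₀, Function.update (fun _ => ∅) k {k}, rfl,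
        Or.inr ⟨hpi, k, by simpa using hT, fun j hj => by simpa [hj] using hg j⟩⟩, ?_, ?_⟩
    · rw [Guard.sat_conj_ofFn]
      intro j
      by_cases hj : j = k
      · subst hj
        simpa using hg₀
      · simpa [hj] using hg' j
    · funext j
      have hmem : j ∈ (⋃ l, Function.update
          (fun _ => (∅ : Set (Fin (Nat.card A.Loc + 1)))) k {k} l) ↔ j = k := by
        rw [mem_iUnion]
        constructor
        · rintro ⟨l, hjl⟩
          by_cases hl : l = k
          · subst hl
            simpa using hjl
          · simp [hl] at hjl
        · rintro rfl
          exact ⟨j, by simp⟩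
      unfold TimedAut.reset
      by_cases hj : j = k
      · rw [if_pos (hmem.2 hj), hj]
        simp
      · rw [if_neg (mt hmem.1 hj)]
        simp [hj]
  · refine ⟨_, _, h.untriggered, _, _,
      ⟨S, _, ρ.letter i, g, fun _ => ∅, rfl, Or.inl ⟨hpi, hg⟩⟩, ?_, ?_⟩
    · exact (Guard.sat_conj_ofFn g _).2 hg'
    · funext j
      simp [TimedAut.reset]

theorem mem_language_of_safeUntil
    (h : ∀ i, p ∈ ρ.letter i → SafeUntil A β ρ i {A.init} (ρ.time i + c)) :
    ρ ∈ (dualLeComponent A β c p).language := by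
  let State := (Fin (Nat.card A.Loc + 1) → Set A.Loc) × (Fin (Nat.card A.Loc + 1) → ℝ)
  have hinit : RunInvariant A β ρ c 0 (fun _ : Fin (Nat.card A.Loc + 1) => ∅) fun _ => 0 :=
    ⟨fun _ => le_rfl, fun _ => safeUntil_empty, fun _ _ _ h => absurd h not_nonempty_empty⟩
  choose! F G hinv hstep using
    fun (i : ℕ) (q : State) (hq : RunInvariant A β ρ c i q.1 q.2) => hq.exists_step (h i)
  let st : ℕ → State := fun i => Nat.rec (fun _ => ∅, fun _ => 0) (fun i q => (F i q, G i q)) i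
  have hst : ∀ i, RunInvariant A β ρ c i (st i).1 (st i).2 := by
    intro i
    induction i with
    | zero => exact hinit
    | succ i ih => exact hinv i (st i) ih
  -- Clock values are recorded just after the previous event, so adding the delay gives the time
  -- since the last reset. Acceptance is vacuous, as `final` is empty.
  refine ⟨fun i => (st i).1, fun i k => ρ.prevTime i - (st i).2 k, ⟨rfl, ?_, fun i => ?_⟩,
    fun _ hF => absurd hF (notMem_empty _)⟩
  · intro k
    exact sub_self (0 : ℝ)
  · obtain ⟨g, r, hgr, hg, hr⟩ := hstep i (st i) (hst i)
    have hv : (fun k => ρ.prevTime i - (st i).2 k + ρ.delay i) =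
        fun k => ρ.time i - (st i).2 k := by
      funext k
      rw [ρ.delay_eq]
      ring
    refine ⟨g, r, hgr, ?_, ?_⟩
    · exact hv ▸ hg
    · exact hr.trans (congrArg (fun u => TimedAut.reset u r) hv.symm)

variable (A β c p) in
theorem dualLeComponent_language : (dualLeComponent A β c p).language =
    (EMITL.globally (EMITL.imp (.atom p)
      (EMITL.dualAut A (.icc 0 c) fun a => (β a).toEMITL))).language := by
  ext ρ
  simp only [EMITL.language, mem_ofPred_eq, EMITL.sat_globally_zero, EMITL.sat_imp,
    sat_dualAut_iff]
  exact ⟨safeUntil_of_mem_language, mem_language_of_safeUntil⟩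

end

end EMITLTA

theorem proposition8 {AP : Type u} [Finite AP] (φ : NNF AP) {n : ℕ} (A : FinAut (Fin n)) (c : ℕ)
    (args : Fin n → NNF AP) (hψ : NNF.dualAut A (.icc 0 c) args ∈ φ.temporal) :
    (dualLeComponent A
        (fun a => φ.bar (args a) (NNF.temporal_arg_subset_of_dualAut_mem hψ a)) c
        (Sum.inr ⟨NNF.dualAut A (.icc 0 c) args, hψ⟩)).language =
      (EMITL.globally (EMITL.imp
        (.atom (Sum.inr ⟨NNF.dualAut A (.icc 0 c) args, hψ⟩))
        (EMITL.dualAut A (.icc 0 c) (fun a =>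
          (φ.bar (args a) (NNF.temporal_arg_subset_of_dualAut_mem hψ a)).toEMITL)))).language :=
  dualLeComponent_language A _ c _
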